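/- For a finite simple graph $G$, let $P_k(G)$ be the largest number of edges in a $k$-partite subgraph of $G$, and let $K_rf(G)$ be the largest number of edges in a $K_r$-free subgraph of $G$. For an integer $r\ge 4$, let $\delta_r$ be the infimum of all real numbers $\delta$ with the following property: there is an $N$ such that every graph $G$ on $n\ge N$ vertices with minimum degree at least $\delta n$ satisfies $P_{r-1}(G)=K_rf(G)$. Then, for every $r\ge 4$, $$\frac{3r-4}{3r-1}<\delta_r\le\frac{4(3r-7)(r-1)+1}{4(r-2)(3r-4)}.$$ -/

import Mathlib

/-- `P_k(G)`: the largest number of edges in a `k`-partite subgraph of the finite graph `G`.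
A subgraph may be taken to be spanning, since isolated vertices change neither the number of edges
nor (for `k ≥ 1`) being `k`-partite; `k`-partite means properly `k`-colourable. The set is nonempty
for `k ≥ 1` and bounded by the number of edges of `G`, so `sSup` is a maximum. -/
noncomputable def maxPartiteEdges {V : Type*} [Finite V] (G : SimpleGraph V) (k : ℕ) : ℕ :=
  sSup {m : ℕ | ∃ H : SimpleGraph V, H ≤ G ∧ H.Colorable k ∧ H.edgeSet.ncard = m}

/-- `K_r f(G)`: the largest number of edges in a `K_r`-free subgraph of the finite graph `G`. -/
noncomputable def maxCliqueFreeEdges {V : Type*} [Finite V] (G : SimpleGraph V) (r : ℕ) : ℕ :=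
  sSup {m : ℕ | ∃ H : SimpleGraph V, H ≤ G ∧ H.CliqueFree r ∧ H.edgeSet.ncard = m}

/-- `δ` is an admissible ratio for `r`: for all sufficiently large `n`, every graph `G` on `n`
vertices with minimum degree at least `δ n` satisfies `P_{r-1}(G) = K_r f(G)`. -/
def ForcesPartiteEqCliqueFree (r : ℕ) (δ : ℝ) : Prop :=
  ∃ N : ℕ, ∀ n : ℕ, N ≤ n → ∀ (G : SimpleGraph (Fin n)) [DecidableRel G.Adj],
    δ * (n : ℝ) ≤ (G.minDegree : ℝ) →
      maxPartiteEdges G (r - 1) = maxCliqueFreeEdges G r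

/-- The threshold `δ_r`: the infimum of the admissible ratios. (Every `δ ≥ 1` is admissible, because
the minimum degree of a graph on `n ≥ 1` vertices is less than `n`. If the set were unbounded below,
this `sInf` would be `0`, so a positive strict lower bound on it is a genuine one.) -/
noncomputable def degreeThreshold (r : ℕ) : ℝ :=
  sInf {δ : ℝ | ForcesPartiteEqCliqueFree r δ}

/-! Upper bound, with `k = r - 1`: take a largest `K_r`-free subgraph `H` and discard vertices of
low degree until the Andrásfai–Erdős–Sós theorem makes the remaining core `S` `k`-colourable
(`exists_colorable_core`). Extend that colouring greedily to all of `G`; this keeps a fraction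
`(k-1)/k` of the edges meeting the complement of `S` (`exists_coloring_extension`). The minimum
degree of `G` makes these at least as many as the edges of `H` lost, provided `S` has at least half
the vertices, which follows from comparing the size of `H` with a greedy `k`-partite subgraph.

Lower bound: blow up a pentagon into five cliques of `m` vertices with consecutive ones completely
joined. Keeping only the pentagon blow-up costs about `5m²` arcs, while every 2-colouring has about
`6m²` monochromatic arcs. The slack pays for extra edges: split each class into `g` groups and join
equal groups of non-consecutive classes. The cost becomes `5m²(1 + 2/g)`, below `6m²` when `g > 10`,
and the degree ratio exceeds `(3r-4)/(3r-1)` when `g < 16`; here `g = 12`. Joining independent sets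
passes from `r` to `r + 1` without changing the deletion cost or lowering the bound on monochromatic
arcs (`monoArcs_joinIndep`). -/

open Finset

/-! ### Counting arcs, and the two extremal edge numbers. -/

/-- The number of ordered pairs of adjacent vertices of `G` inside `S`. -/
noncomputable def arcsIn {V : Type*} (G : SimpleGraph V) (S : Finset V) : ℕ :=
  open Classical in ∑ u ∈ S, ∑ v ∈ S, if G.Adj u v then 1 else 0

/-- The number of neighbours of `v` in `S`. -/
noncomputable def degIn {V : Type*} (G : SimpleGraph V) (v : V) (S : Finset V) : ℕ :=
  open Classical in ∑ u ∈ S, if G.Adj v u then 1 else 0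

/-- The subgraph of `G` formed by the edges whose ends receive different colours. -/
def cutGraph {V C : Type*} (G : SimpleGraph V) (c : V → C) : SimpleGraph V where
  Adj u v := G.Adj u v ∧ c u ≠ c v
  symm := ⟨fun _ _ h => ⟨h.1.symm, h.2.symm⟩⟩
  loopless := ⟨fun _ h => h.2 rfl⟩

theorem cutGraph_le {V C : Type*} (G : SimpleGraph V) (c : V → C) : cutGraph G c ≤ G :=
  fun _ _ h => h.1

theorem cutGraph_colorable {V : Type*} (G : SimpleGraph V) {k : ℕ} (c : V → Fin k) :
    (cutGraph G c).Colorable k :=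
  ⟨SimpleGraph.Coloring.mk c fun h => h.2⟩

theorem degIn_eq_card {V : Type*} (G : SimpleGraph V) (v : V) (S : Finset V) [DecidableRel G.Adj] :
    degIn G v S = #{u ∈ S | G.Adj v u} := by
  classical
  rw [degIn, card_filter]
  exact sum_congr rfl fun _ _ => by congr

theorem arcsIn_eq_sum_degIn {V : Type*} (G : SimpleGraph V) (S : Finset V) :
    arcsIn G S = ∑ u ∈ S, degIn G u S := rfl

theorem arcsIn_mono {V : Type*} {G H : SimpleGraph V} {S : Finset V}
    (h : ∀ u ∈ S, ∀ v ∈ S, G.Adj u v → H.Adj u v) : arcsIn G S ≤ arcsIn H S := by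
  classical
  refine sum_le_sum fun u hu => sum_le_sum fun v hv => ?_
  by_cases h' : G.Adj u v
  · simp [h', h u hu v hv h']
  · simp [h']

theorem arcsIn_congr {V : Type*} {G H : SimpleGraph V} {S : Finset V}
    (h : ∀ u ∈ S, ∀ v ∈ S, G.Adj u v ↔ H.Adj u v) : arcsIn G S = arcsIn H S :=
  le_antisymm (arcsIn_mono fun u hu v hv => (h u hu v hv).1)
    (arcsIn_mono fun u hu v hv => (h u hu v hv).2)

theorem arcsIn_insert {V : Type*} [DecidableEq V] (G : SimpleGraph V) {v : V} {S : Finset V}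
    (hv : v ∉ S) : arcsIn G (insert v S) = arcsIn G S + 2 * degIn G v S := by
  classical
  have h : ∑ u ∈ S, (if G.Adj u v then 1 else 0) = degIn G v S :=
    sum_congr rfl fun u _ => by simp [G.adj_comm]
  rw [arcsIn, sum_insert hv, sum_insert hv]
  simp_rw [sum_insert hv, sum_add_distrib]
  rw [h]
  simp only [SimpleGraph.irrefl, if_false]
  change 0 + degIn G v S + (degIn G v S + arcsIn G S) = _
  ring

theorem two_mul_ncard_edgeSet {V : Type*} [Fintype V] (G : SimpleGraph V) :
    2 * G.edgeSet.ncard = arcsIn G univ := by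
  classical
  rw [← SimpleGraph.coe_edgeFinset, Set.ncard_coe_finset, ← G.sum_degrees_eq_twice_card_edges,
    arcsIn_eq_sum_degIn]
  refine sum_congr rfl fun u _ => ?_
  rw [degIn_eq_card, ← SimpleGraph.card_neighborFinset_eq_degree,
    SimpleGraph.neighborFinset_eq_filter]

theorem bddAbove_ncard_edgeSet {V : Type*} [Finite V] (G : SimpleGraph V)
    (p : SimpleGraph V → Prop) :
    BddAbove {m : ℕ | ∃ H : SimpleGraph V, H ≤ G ∧ p H ∧ H.edgeSet.ncard = m} :=
  ⟨G.edgeSet.ncard, by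
    rintro m ⟨H, hH, -, rfl⟩
    exact Set.ncard_le_ncard (SimpleGraph.edgeSet_mono hH) (Set.toFinite _)⟩

theorem exists_ncard_eq_maxCliqueFreeEdges {V : Type*} [Finite V] (G : SimpleGraph V) {r : ℕ}
    (hr : 2 ≤ r) :
    ∃ H ≤ G, H.CliqueFree r ∧ H.edgeSet.ncard = maxCliqueFreeEdges G r :=
  Nat.sSup_mem (s := {m : ℕ | ∃ H ≤ G, H.CliqueFree r ∧ H.edgeSet.ncard = m})
    ⟨_, ⊥, bot_le, SimpleGraph.cliqueFree_bot hr, rfl⟩ (bddAbove_ncard_edgeSet G _)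

theorem exists_ncard_eq_maxPartiteEdges {V : Type*} [Finite V] (G : SimpleGraph V) {k : ℕ}
    (hk : 1 ≤ k) :
    ∃ H ≤ G, H.Colorable k ∧ H.edgeSet.ncard = maxPartiteEdges G k :=
  Nat.sSup_mem (s := {m : ℕ | ∃ H ≤ G, H.Colorable k ∧ H.edgeSet.ncard = m})
    ⟨_, ⊥, bot_le, ⟨SimpleGraph.Coloring.mk (fun _ => ⟨0, hk⟩) (by simp)⟩, rfl⟩
    (bddAbove_ncard_edgeSet G _)

theorem ncard_le_maxCliqueFreeEdges {V : Type*} [Finite V] {G H : SimpleGraph V} {r : ℕ}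
    (hH : H ≤ G) (hf : H.CliqueFree r) : H.edgeSet.ncard ≤ maxCliqueFreeEdges G r :=
  le_csSup (bddAbove_ncard_edgeSet G _) ⟨H, hH, hf, rfl⟩

theorem ncard_le_maxPartiteEdges {V : Type*} [Finite V] {G H : SimpleGraph V} {k : ℕ}
    (hH : H ≤ G) (hc : H.Colorable k) : H.edgeSet.ncard ≤ maxPartiteEdges G k :=
  le_csSup (bddAbove_ncard_edgeSet G _) ⟨H, hH, hc, rfl⟩

theorem maxPartiteEdges_le_maxCliqueFreeEdges {V : Type*} [Finite V] (G : SimpleGraph V) {k : ℕ}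
    (hk : 1 ≤ k) : maxPartiteEdges G k ≤ maxCliqueFreeEdges G (k + 1) := by
  obtain ⟨H, hH, hc, h⟩ := exists_ncard_eq_maxPartiteEdges G hk
  exact h ▸ ncard_le_maxCliqueFreeEdges hH (hc.cliqueFree (Nat.lt_succ_self k))

/-! ### Upper bound: coloured core and greedy extension. -/

/-- Extending a colouring of `S` greedily to `S ∪ T` keeps at least the fraction `(k - 1) / k` of
the new edges. -/
theorem exists_coloring_extension {V : Type*} [DecidableEq V] (G : SimpleGraph V) {k : ℕ}
    (hk : 1 ≤ k) (S : Finset V) (c : V → Fin k) (T : Finset V) (hT : Disjoint S T) :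
    ∃ c' : V → Fin k, k * arcsIn (cutGraph G c) S + (k - 1) * arcsIn G (S ∪ T) ≤
      k * arcsIn (cutGraph G c') (S ∪ T) + (k - 1) * arcsIn G S := by
  classical
  induction T using Finset.induction_on with
  | empty => exact ⟨c, by simp⟩
  | insert v T hv ih =>
    obtain ⟨c', hc'⟩ := ih (hT.mono_right (subset_insert _ _))
    have hvU : v ∉ S ∪ T := by
      have := disjoint_left.1 hT.symm (mem_insert_self v T)
      simp [hv, this]
    -- The new vertex takes the colour rarest among its neighbours in `S ∪ T`, losing at most a
    -- `1/k` share of its edges there.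
    obtain ⟨γ, -, hγ⟩ := exists_min_image (univ : Finset (Fin k))
      (fun γ => #{u ∈ S ∪ T | G.Adj v u ∧ c' u = γ}) ⟨⟨0, hk⟩, mem_univ _⟩
    have hmin : k * #{u ∈ S ∪ T | G.Adj v u ∧ c' u = γ} ≤ degIn G v (S ∪ T) := by
      rw [degIn_eq_card, card_eq_sum_card_fiberwise (f := c') (s := {u ∈ S ∪ T | G.Adj v u})
        (t := univ) (by simp)]
      simp only [filter_filter]
      have := card_nsmul_le_sum (univ : Finset (Fin k)) _ _ hγ
      simpa using this
    refine ⟨Function.update c' v γ, ?_⟩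
    have hne : ∀ u ∈ S ∪ T, Function.update c' v γ u = c' u := fun u hu =>
      Function.update_of_ne (fun h : u = v => hvU (h ▸ hu)) _ _
    have h1 : arcsIn (cutGraph G (Function.update c' v γ)) (S ∪ T) =
        arcsIn (cutGraph G c') (S ∪ T) := arcsIn_congr fun u hu w hw => by
      simp only [cutGraph, hne u hu, hne w hw]
    have h2 : degIn (cutGraph G (Function.update c' v γ)) v (S ∪ T) +
        #{u ∈ S ∪ T | G.Adj v u ∧ c' u = γ} = degIn G v (S ∪ T) := by
      rw [degIn_eq_card, degIn_eq_card,
        ← card_filter_add_card_filter_not (s := {u ∈ S ∪ T | G.Adj v u}) (fun u => c' u ≠ γ),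
        filter_filter, filter_filter]
      congr 2
      · refine filter_congr fun u hu => ?_
        simp only [cutGraph, Function.update_self, hne u hu, ne_comm]
      · simp
    rw [union_insert, arcsIn_insert _ hvU, arcsIn_insert _ hvU, h1]
    obtain ⟨k, rfl⟩ := Nat.exists_eq_add_of_le' hk
    simp only [Nat.add_sub_cancel] at *
    nlinarith

/-- Removing vertices of low degree from a `K_{k+1}`-free graph leaves a vertex set `S` that induces
a `k`-colourable graph, by the Andrásfai–Erdős–Sós theorem; the inequality bounds the number of
edges that are lost. -/
theorem exists_colorable_core {V : Type*} [Fintype V] (H : SimpleGraph V) {k : ℕ} (hk : 2 ≤ k)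
    (hH : H.CliqueFree (k + 1)) :
    ∃ (S : Finset V) (c : V → Fin k), (∀ u ∈ S, ∀ v ∈ S, H.Adj u v → c u ≠ c v) ∧
      (3 * k - 1) * (arcsIn H univ : ℝ) + (3 * k - 4) * (#S * (#S + 1)) ≤
        (3 * k - 1) * arcsIn H S + (3 * k - 4) * (Fintype.card V * (Fintype.card V + 1)) := by
  classical
  -- A smallest `S` satisfying the inequality. Deleting a vertex of degree `d` lowers the arcs by
  -- `2d` and `#S * (#S + 1)` by `2 * #S`, so minimality forces every degree in `S` above the
  -- Andrásfai–Erdős–Sós bound.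
  obtain ⟨S, hS, hmin⟩ := exists_min_image (univ.filter fun S : Finset V =>
    (3 * k - 1) * (arcsIn H univ : ℝ) + (3 * k - 4) * (#S * (#S + 1)) ≤
        (3 * k - 1) * arcsIn H S + (3 * k - 4) * (Fintype.card V * (Fintype.card V + 1)))
    (fun S => #S) ⟨univ, by simp⟩
  simp only [mem_filter, mem_univ, true_and] at hS hmin
  have hk' : (2 : ℝ) ≤ k := by exact_mod_cast hk
  have hdeg : ∀ v ∈ S, (3 * k - 4) * (#S : ℝ) < (3 * k - 1) * degIn H v S := by
    intro v hv
    by_contra! hlt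
    have hins : insert v (S.erase v) = S := insert_erase hv
    have hcard : (#S : ℝ) = #(S.erase v) + 1 := by
      rw [card_erase_of_mem hv, Nat.cast_sub (card_pos.2 ⟨v, hv⟩)]; simp
    have harc := arcsIn_insert H (notMem_erase v S)
    rw [hins] at harc
    have hd : degIn H v S = degIn H v (S.erase v) := by
      conv_lhs => rw [← hins, degIn, sum_insert (notMem_erase v S)]
      simp [degIn]
    rw [← hd] at harc
    have := hmin (S.erase v) (by
      rw [harc, hcard] at hS
      rw [hcard] at hlt
      push_cast at hS ⊢
      nlinarith)
    rw [card_erase_of_mem hv] at this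
    have := card_pos.2 ⟨v, hv⟩
    omega
  have hcol : (H.induce (S : Set V)).Colorable k := by
    rcases S.eq_empty_or_nonempty with rfl | hne
    · exact ⟨SimpleGraph.Coloring.mk (fun x => absurd x.2 (by simp)) (fun {x} => absurd x.2 (by simp))⟩
    · have : Nonempty (S : Set V) := hne.to_subtype
      refine SimpleGraph.colorable_of_cliqueFree_lt_minDegree
        (hH.comap (SimpleGraph.Embedding.induce _).isContained) ?_
      obtain ⟨v, hv⟩ := (H.induce (S : Set V)).exists_minimal_degree_vertex
      have h1 : (H.induce (S : Set V)).degree v = degIn H v S := by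
        rw [degIn_eq_card, ← SimpleGraph.card_neighborFinset_eq_degree,
          SimpleGraph.neighborFinset_eq_filter, ← card_map (Function.Embedding.subtype _)]
        congr 1
        ext u
        simp [and_comm]
      rw [hv, h1]
      refine Nat.div_lt_of_lt_mul ?_
      have h2 := hdeg v v.2
      have h3 : Fintype.card (S : Set V) = #S := by simp
      rw [h3]
      obtain ⟨k, rfl⟩ := Nat.exists_eq_add_of_le' hk
      rw [show 3 * (k + 2) - 4 = 3 * k + 2 by omega, show 3 * (k + 2) - 1 = 3 * k + 5 by omega]
      push_cast at h2
      have h4 : (3 * k + 2 : ℝ) * #S < (3 * k + 5) * degIn H v S := by linarith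
      exact_mod_cast h4
  obtain ⟨C⟩ := hcol
  refine ⟨S, fun v => if h : v ∈ S then C ⟨v, h⟩ else ⟨0, by omega⟩, ?_, hS⟩
  intro u hu v hv huv
  simp only [hu, hv, dif_pos]
  exact C.valid huv

/-- Turán-type bound: by Cauchy–Schwarz at least `#S² / k` ordered pairs have equal colours, and
none of these is an arc. -/
theorem mul_arcsIn_le_of_coloring {V : Type*} (H : SimpleGraph V) {k : ℕ} (S : Finset V)
    (c : V → Fin k) (hc : ∀ u ∈ S, ∀ v ∈ S, H.Adj u v → c u ≠ c v) :
    k * arcsIn H S + #S ^ 2 ≤ k * #S ^ 2 := by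
  classical
  have h1 : arcsIn H S + ∑ γ, #{u ∈ S | c u = γ} ^ 2 ≤ #S ^ 2 := by
    have h2 : ∑ γ, #{u ∈ S | c u = γ} ^ 2 = ∑ u ∈ S, ∑ v ∈ S, if c u = c v then 1 else 0 := by
      simp_rw [sq, ← card_filter]
      rw [← sum_fiberwise S c]
      refine sum_congr rfl fun γ _ => ?_
      rw [← smul_eq_mul, ← sum_const]
      refine sum_congr rfl fun u hu => ?_
      rw [(mem_filter.1 hu).2]
      simp_rw [eq_comm]
    rw [h2, arcsIn, ← sum_add_distrib, sq, ← smul_eq_mul, ← sum_const]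
    refine sum_le_sum fun u hu => ?_
    rw [← sum_add_distrib, card_eq_sum_ones]
    refine sum_le_sum fun v hv => ?_
    have := hc u hu v hv
    split_ifs <;> simp_all
  have h3 : #S ^ 2 ≤ k * ∑ γ, #{u ∈ S | c u = γ} ^ 2 := by
    have := sq_sum_le_card_mul_sum_sq (s := (univ : Finset (Fin k)))
      (f := fun γ => #{u ∈ S | c u = γ})
    rwa [← card_eq_sum_card_fiberwise (by simp), card_univ, Fintype.card_fin] at this
  nlinarith

/-- The edges meeting the complement of `S`, counted from the degrees. -/
theorem le_arcsIn_univ_sub {V : Type*} [Fintype V] (G : SimpleGraph V) {d : ℝ}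
    (hd : ∀ v, d ≤ degIn G v univ) (S : Finset V) :
    arcsIn G S + 2 * d * (Fintype.card V - #S) ≤
      arcsIn G univ + (Fintype.card V - #S : ℝ) * (Fintype.card V - #S - 1) := by
  classical
  have h1 : arcsIn G univ = ∑ u ∈ S, degIn G u S + ∑ v ∈ Sᶜ, degIn G v S +
      ∑ v ∈ Sᶜ, degIn G v univ := by
    have h2 : ∑ v ∈ Sᶜ, degIn G v S = ∑ u ∈ S, degIn G u Sᶜ := by
      simp only [degIn]
      rw [sum_comm]
      simp_rw [G.adj_comm]
    rw [h2, ← sum_add_distrib, arcsIn_eq_sum_degIn, ← sum_add_sum_compl S]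
    congr 1
    exact sum_congr rfl fun u _ => (sum_add_sum_compl S _).symm
  -- A vertex outside `S` has at most `#Sᶜ - 1` neighbours outside `S`.
  have h3 : ∀ v ∈ Sᶜ, d - (#Sᶜ - 1) ≤ degIn G v S := by
    intro v hv
    have h4 : degIn G v S + degIn G v Sᶜ = degIn G v univ := sum_add_sum_compl S _
    have h5 : degIn G v Sᶜ < #Sᶜ := by
      rw [degIn_eq_card]
      exact card_lt_card (filter_ssubset.2 ⟨v, hv, by simp⟩)
    have h6 := hd v
    rw [← h4] at h6
    have h7 : (degIn G v Sᶜ : ℝ) + 1 ≤ #Sᶜ := by exact_mod_cast h5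
    push_cast at h6
    linarith
  have h8 := card_nsmul_le_sum Sᶜ _ _ h3
  have h9 := card_nsmul_le_sum Sᶜ _ _ fun v _ => hd v
  have h10 : (Fintype.card V : ℝ) = #S + #Sᶜ := by exact_mod_cast (card_add_card_compl S).symm
  rw [h1, h10, arcsIn_eq_sum_degIn]
  push_cast
  rw [nsmul_eq_mul] at h8 h9
  nlinarith

/-- If the minimum degree is large enough, any `K_{k+1}`-free subgraph has at most as many edges
as some `k`-partite subgraph. -/
theorem maxCliqueFreeEdges_le_maxPartiteEdges {V : Type*} [Fintype V] (G : SimpleGraph V) {k : ℕ}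
    (hk : 2 ≤ k) {δ ε : ℝ} (hε : 0 < ε) (hδ : 4 * (k - 1) * (3 * k - 1) * (1 - δ) = 3 - 4 * ε)
    (hn : k * (3 * k - 4) ≤ ε * Fintype.card V)
    (hd : ∀ v, δ * Fintype.card V ≤ degIn G v univ) :
    maxCliqueFreeEdges G (k + 1) ≤ maxPartiteEdges G k := by
  classical
  obtain ⟨H, hHG, hfree, hH⟩ := exists_ncard_eq_maxCliqueFreeEdges G (r := k + 1) (by omega)
  obtain ⟨S, c, hc, hcore⟩ := exists_colorable_core H hk hfree
  -- `c₁` is greedy from scratch and serves to show that `S` is large; `c₂` extends the colouring of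
  -- the core and is the one competing with `H`.
  obtain ⟨c₁, hc₁⟩ := exists_coloring_extension G (by omega) ∅ c univ (by simp)
  obtain ⟨c₂, hc₂⟩ := exists_coloring_extension G (by omega) S c Sᶜ disjoint_compl_right
  have hle : ∀ c' : V → Fin k, arcsIn (cutGraph G c') univ ≤ 2 * maxPartiteEdges G k := by
    intro c'
    rw [← two_mul_ncard_edgeSet]
    exact Nat.mul_le_mul_left 2 (ncard_le_maxPartiteEdges (cutGraph_le G c')
      (cutGraph_colorable G c'))
  have hHcut : arcsIn H S ≤ arcsIn (cutGraph G c) S :=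
    arcsIn_mono fun u hu v hv h => ⟨hHG h, hc u hu v hv h⟩
  have hturan := mul_arcsIn_le_of_coloring H S c hc
  have hsub := le_arcsIn_univ_sub G hd S
  have hPK := maxPartiteEdges_le_maxCliqueFreeEdges G (k := k) (by omega)
  have hSn := card_le_univ S
  have hH2 := two_mul_ncard_edgeSet H
  rw [hH] at hH2
  rw [union_compl] at hc₂
  rw [empty_union] at hc₁
  have h1 := hle c₁
  have h2 := hle c₂
  have hg : δ * Fintype.card V ^ 2 ≤ arcsIn G univ := by
    have := card_nsmul_le_sum univ _ _ fun v _ => hd v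
    rw [nsmul_eq_mul, card_univ] at this
    rw [arcsIn_eq_sum_degIn]
    push_cast
    linarith
  have hempty : ∀ G' : SimpleGraph V, arcsIn G' ∅ = 0 := fun _ => rfl
  rw [hempty, hempty] at hc₁
  clear hle hc hd
  have hK : maxCliqueFreeEdges G (k + 1) = H.edgeSet.ncard := hH.symm
  generalize maxCliqueFreeEdges G (k + 1) = K at *
  generalize maxPartiteEdges G k = P at *
  generalize arcsIn (cutGraph G c₁) univ = a₁ at *
  generalize arcsIn (cutGraph G c₂) univ = a₂ at *
  generalize arcsIn (cutGraph G c) S = cS at *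
  generalize arcsIn G S = gS at *
  generalize arcsIn G univ = g at *
  generalize arcsIn H S = hS at *
  generalize arcsIn H univ = h at *
  generalize Fintype.card V = n at *
  generalize #S = s at *
  subst hH2
  obtain ⟨j, rfl⟩ := Nat.exists_eq_add_of_le hk
  rw [show 2 + j - 1 = j + 1 by omega] at hc₁ hc₂
  have e1 : ((j : ℝ) + 1) * g ≤ (j + 2) * (2 * P) := by
    have : (j + 1) * g ≤ (j + 2) * (2 * P) := by nlinarith
    exact_mod_cast this
  have e2 : ((j : ℝ) + 2) * hS + (j + 1) * g ≤ (j + 2) * (2 * P) + (j + 1) * gS := by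
    have : (j + 2) * hS + (j + 1) * g ≤ (j + 2) * (2 * P) + (j + 1) * gS := by nlinarith
    exact_mod_cast this
  have e3 : ((j : ℝ) + 2) * hS ≤ (j + 1) * s ^ 2 := by
    have : (j + 2) * hS ≤ (j + 1) * s ^ 2 := by nlinarith
    exact_mod_cast this
  have e4 : (P : ℝ) ≤ K := by exact_mod_cast hPK
  have e5 : (s : ℝ) ≤ n := by exact_mod_cast hSn
  have hj : (0 : ℝ) ≤ j := by positivity
  have hs0 : (0 : ℝ) ≤ s := by positivity
  have hn0 : (0 : ℝ) ≤ n := by positivity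
  clear hc₁ hc₂ hturan hPK hSn h1 h2 hHcut hempty hH hK hfree hHG
  push_cast at hcore hδ hn
  suffices h : (K : ℝ) ≤ P by exact_mod_cast h
  generalize (K : ℝ) = K at *
  generalize (P : ℝ) = P at *
  generalize (g : ℝ) = g at *
  generalize (gS : ℝ) = gS at *
  generalize (hS : ℝ) = hS at *
  generalize (s : ℝ) = s at *
  generalize (n : ℝ) = n at *
  generalize (j : ℝ) = j at *
  have hA : (3 * j + 5) * (j + 1) * δ = (3 * j + 5) * (j + 1) - 3 / 4 + ε := by linarith
  have hcore' : (j + 2) * (3 * j + 5) * (2 * K) ≤ (3 * j + 5) * ((j + 2) * hS) +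
      (j + 2) * (3 * j + 2) * ((n - s) * (n + s + 1)) := by
    have := mul_le_mul_of_nonneg_left hcore (show 0 ≤ j + 2 by linarith)
    linarith
  have f1 : (3 * j + 5) * ((j + 1) * (δ * n ^ 2)) ≤ (j + 2) * (3 * j + 5) * (2 * K) := by
    have u1 : (j + 1) * (δ * n ^ 2) ≤ (j + 1) * g :=
      mul_le_mul_of_nonneg_left hg (by linarith)
    have u2 : (j + 2) * (2 * P) ≤ (j + 2) * (2 * K) :=
      mul_le_mul_of_nonneg_left (by linarith) (by linarith)
    have := mul_le_mul_of_nonneg_left (u1.trans (e1.trans u2)) (show 0 ≤ 3 * j + 5 by linarith)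
    linarith
  have f2 : (3 * j + 5) * ((j + 2) * hS) ≤ (3 * j + 5) * ((j + 1) * s ^ 2) :=
    mul_le_mul_of_nonneg_left e3 (by linarith)
  -- Lower and upper bounds on `K` combined. The linear term is absorbed by `ε * n ^ 2`, whence `s ≥
  -- n / 2`.
  have f3 : (1 / 4 + ε) * n ^ 2 ≤ s ^ 2 + (j + 2) * (3 * j + 2) * (n - s) := by
    have u : (3 * j + 5) * ((j + 1) * (δ * n ^ 2)) =
      ((3 * j + 5) * (j + 1) - 3 / 4 + ε) * n ^ 2 := by rw [← hA]; ring
    nlinarith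
  have f4 : (j + 2) * (3 * j + 2) * (n - s) ≤ ε * n * n :=
    mul_le_mul (by linarith) (by linarith) (by linarith) (by positivity)
  have f5 : n ≤ 2 * s := abs_le_of_sq_le_sq' (by nlinarith) (by linarith) |>.2
  have f6 : (3 * j + 5) * ((j + 2) * hS) + (3 * j + 5) * ((j + 1) * (g - gS)) ≤
      (3 * j + 5) * ((j + 2) * (2 * P)) := by
    rw [← mul_add]
    exact mul_le_mul_of_nonneg_left (by linarith) (by linarith)
  have f7 : (3 * j + 5) * ((j + 1) * ((n - s) * (2 * δ * n - (n - s - 1)))) ≤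
      (3 * j + 5) * ((j + 1) * (g - gS)) :=
    mul_le_mul_of_nonneg_left (mul_le_mul_of_nonneg_left (by linarith) (by linarith))
      (by linarith)
  -- Gain minus loss is exactly the last product. The value of `δ` is tuned so that its second
  -- factor is nonnegative once `s ≥ n / 2`.
  have f8 : (3 * j + 5) * ((j + 1) * ((n - s) * (2 * δ * n - (n - s - 1)))) =
      (j + 2) * (3 * j + 2) * ((n - s) * (n + s + 1)) +
        (n - s) * (s - n / 2 + 1 + 2 * ε * n) := by
    linear_combination (2 * n * (n - s)) * hA
  have f9 : 0 ≤ (n - s) * (s - n / 2 + 1 + 2 * ε * n) :=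
    mul_nonneg (by linarith) (by have := mul_nonneg hε.le hn0; linarith)
  have f10 : (j + 2) * (3 * j + 5) * (2 * K) ≤ (j + 2) * (3 * j + 5) * (2 * P) := by linarith
  have := le_of_mul_le_mul_left f10 (by positivity)
  linarith

theorem forcesPartiteEqCliqueFree_of_lt {r : ℕ} (hr : 3 ≤ r) {δ : ℝ}
    (hδ : (4 * (3 * (r : ℝ) - 7) * ((r : ℝ) - 1) + 1) /
      (4 * ((r : ℝ) - 2) * (3 * (r : ℝ) - 4)) < δ) : ForcesPartiteEqCliqueFree r δ := by
  obtain ⟨k, rfl⟩ : ∃ k, r = k + 1 := ⟨r - 1, by omega⟩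
  have hk : (2 : ℝ) ≤ k := by exact_mod_cast (by omega : 2 ≤ k)
  push_cast at hδ
  rw [div_lt_iff₀ (by nlinarith)] at hδ
  obtain ⟨ε, hε⟩ : ∃ ε : ℝ, ε = (3 - 4 * (k - 1) * (3 * k - 1) * (1 - δ)) / 4 := ⟨_, rfl⟩
  have hε0 : 0 < ε := by rw [hε]; linarith
  refine ⟨⌈k * (3 * k - 4) / ε⌉₊, fun n hn G _ hG => ?_⟩
  have hn' : k * (3 * k - 4) / ε ≤ n := (Nat.le_ceil _).trans (by exact_mod_cast hn)
  rw [div_le_iff₀ hε0] at hn'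
  refine le_antisymm (maxPartiteEdges_le_maxCliqueFreeEdges G (by omega)) ?_
  refine maxCliqueFreeEdges_le_maxPartiteEdges G (by omega) hε0 (δ := δ) (by rw [hε]; ring)
    (by rw [Fintype.card_fin]; linarith) fun v => ?_
  rw [Fintype.card_fin, degIn_eq_card, ← SimpleGraph.neighborFinset_eq_filter,
    SimpleGraph.card_neighborFinset_eq_degree]
  exact hG.trans (by exact_mod_cast G.minDegree_le_degree v)

/-! ### Lower bound: monochromatic arcs, joins and deletion cost. -/

/-- The number of ordered pairs of adjacent vertices of the same colour. -/
noncomputable def monoArcs {V C : Type*} [Fintype V] (G : SimpleGraph V) (c : V → C) : ℕ :=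
  open Classical in ∑ u, ∑ v, if G.Adj u v ∧ c u = c v then 1 else 0

theorem arcsIn_cutGraph_add_monoArcs {V C : Type*} [Fintype V] (G : SimpleGraph V) (c : V → C) :
    arcsIn (cutGraph G c) univ + monoArcs G c = arcsIn G univ := by
  classical
  simp only [arcsIn, monoArcs, ← sum_add_distrib]
  refine sum_congr rfl fun u _ => sum_congr rfl fun v _ => ?_
  by_cases h : G.Adj u v <;> by_cases h' : c u = c v <;> simp [cutGraph, h, h']

/-- Merging one colour class with another one: on average over the other classes this creates few
monochromatic edges. -/
theorem exists_monoArcs_le_of_merge {V : Type*} [Fintype V] (G : SimpleGraph V) {k s : ℕ}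
    (hk : 1 ≤ k) (hdeg : ∀ v, degIn G v univ ≤ k * s) (c : V → Fin (k + 1)) (γ : Fin (k + 1)) :
    ∃ c' : V → Fin k, monoArcs G c' ≤ monoArcs G c + 2 * (#{v | c v = γ} * s) := by
  classical
  -- `g β` merges colour `γ` into the `β`-th other colour. An edge with exactly one end coloured `γ`
  -- and not yet monochromatic becomes so for just one `β`.
  let g (β : Fin k) : Fin (k + 1) → Fin k := Fin.insertNth (α := fun _ => Fin k) γ β id
  have hgγ : ∀ β, g β γ = β := fun β => Fin.insertNth_apply_same _ _ _
  have hgs : ∀ β j, g β (γ.succAbove j) = j := fun β j => Fin.insertNth_apply_succAbove _ _ _ _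
  have hpt : ∀ a b : Fin (k + 1), (∑ β, if g β a = g β b then 1 else 0) ≤
      k * (if a = b then 1 else 0) + ((if a = γ then 1 else 0) + if b = γ then 1 else 0) := by
    intro a b
    rcases Fin.eq_self_or_eq_succAbove γ a with ha | ⟨i, ha⟩ <;>
      rcases Fin.eq_self_or_eq_succAbove γ b with hb | ⟨j, hb⟩ <;> rw [ha, hb]
    · simp
    · simp [hgγ, hgs, (Fin.succAbove_ne γ _).symm]
    · simp [hgγ, hgs, (Fin.succAbove_ne γ _)]
    · simp only [hgs]
      by_cases h : i = j <;> simp [h]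
  have hsum : ∑ β, monoArcs G (g β ∘ c) ≤
      k * (monoArcs G c + 2 * (#{v | c v = γ} * s)) := by
    have h1 : ∑ β, monoArcs G (g β ∘ c) =
        ∑ u, ∑ v, if G.Adj u v then ∑ β, (if g β (c u) = g β (c v) then 1 else 0) else 0 := by
      simp only [monoArcs, Function.comp]
      rw [sum_comm]
      refine sum_congr rfl fun u _ => ?_
      rw [sum_comm]
      refine sum_congr rfl fun v _ => ?_
      by_cases h : G.Adj u v <;> simp [h]
    have h2 : ∑ u, (if c u = γ then degIn G u univ else 0) ≤ #{v | c v = γ} * (k * s) := by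
      rw [← sum_filter, ← smul_eq_mul]
      exact sum_le_card_nsmul _ _ _ fun v _ => hdeg v
    have h3 : ∀ u, degIn G u univ = ∑ v, if G.Adj u v then 1 else 0 := fun _ => rfl
    have h4 : ∑ β, monoArcs G (g β ∘ c) ≤ k * monoArcs G c +
        (∑ u, (if c u = γ then degIn G u univ else 0) +
          ∑ u, (if c u = γ then degIn G u univ else 0)) := by
      have h5 : ∑ u, (if c u = γ then degIn G u univ else 0) =
          ∑ u, ∑ v, if G.Adj u v then (if c u = γ then 1 else 0) else 0 := by
        refine sum_congr rfl fun u _ => ?_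
        by_cases h : c u = γ <;> simp [h, h3]
      have h6 : ∑ u, (if c u = γ then degIn G u univ else 0) =
          ∑ u, ∑ v, if G.Adj u v then (if c v = γ then 1 else 0) else 0 := by
        rw [h5, sum_comm]
        simp_rw [G.adj_comm]
      conv_rhs => enter [2, 1]; rw [h5]
      rw [h6, h1, monoArcs, mul_sum, ← sum_add_distrib, ← sum_add_distrib]
      refine sum_le_sum fun u _ => ?_
      rw [mul_sum, ← sum_add_distrib, ← sum_add_distrib]
      refine sum_le_sum fun v _ => ?_
      by_cases h : G.Adj u v
      · simpa [h] using hpt (c u) (c v)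
      · simp [h]
    nlinarith
  obtain ⟨β, -, hβ⟩ := exists_le_of_sum_le (s := (univ : Finset (Fin k)))
    (f := fun β => monoArcs G (g β ∘ c)) (g := fun _ => monoArcs G c + 2 * (#{v | c v = γ} * s))
    ⟨⟨0, hk⟩, mem_univ _⟩ (by simpa using hsum)
  exact ⟨_, hβ⟩

/-- The join of `G` with an independent set indexed by `W`. -/
def joinIndep {V : Type*} (G : SimpleGraph V) (W : Type*) : SimpleGraph (V ⊕ W) where
  Adj
    | .inl u, .inl v => G.Adj u v
    | .inr _, .inr _ => False
    | _, _ => True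
  symm := ⟨by rintro (u | u) (v | v) h <;> first | exact h.symm | exact h⟩
  loopless := ⟨by rintro (u | u) h; exacts [G.loopless.irrefl u h, h]⟩

section joinIndep

variable {V W : Type*} {G : SimpleGraph V}

@[simp] theorem joinIndep_inl_inl {u v : V} :
    (joinIndep G W).Adj (.inl u) (.inl v) ↔ G.Adj u v := Iff.rfl

@[simp] theorem joinIndep_inl_inr {u : V} {v : W} :
    (joinIndep G W).Adj (.inl u) (.inr v) ↔ True := Iff.rfl

@[simp] theorem joinIndep_inr_inl {u : V} {v : W} :
    (joinIndep G W).Adj (.inr v) (.inl u) ↔ True := Iff.rfl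

@[simp] theorem joinIndep_inr_inr {u v : W} :
    (joinIndep G W).Adj (.inr u) (.inr v) ↔ False := Iff.rfl

theorem joinIndep_mono {H : SimpleGraph V} (h : H ≤ G) : joinIndep H W ≤ joinIndep G W := by
  rintro (u | u) (v | v) huv
  exacts [h huv, huv, huv, huv]

theorem joinIndep_cliqueFree {n : ℕ} (h : G.CliqueFree n) :
    (joinIndep G W).CliqueFree (n + 1) := by
  classical
  intro t ht
  have hright : #t.toRight ≤ 1 := by
    rw [card_le_one]
    intro a ha b hb
    by_contra hab
    exact ht.isClique (mem_toRight.1 ha) (mem_toRight.1 hb) (by simpa using hab)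
  have hcard := card_toLeft_add_card_toRight (u := t)
  have hleft : n ≤ #t.toLeft := by have := ht.card_eq; omega
  refine h.mono hleft t.toLeft ⟨fun a ha b hb hab => ?_, rfl⟩
  exact ht.isClique (mem_toLeft.1 ha) (mem_toLeft.1 hb) (by simpa using hab)

variable [Fintype V] [Fintype W]

theorem degIn_joinIndep_inl (v : V) :
    degIn (joinIndep G W) (.inl v) univ = degIn G v univ + Fintype.card W := by
  simp [degIn, -sum_boole]
  rfl

theorem degIn_joinIndep_inr (w : W) :
    degIn (joinIndep G W) (.inr w) univ = Fintype.card V := by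
  simp [degIn, -sum_boole]

theorem monoArcs_joinIndep {k : ℕ} (hk : 1 ≤ k)
    (hdeg : ∀ v, degIn G v univ ≤ k * Fintype.card W) {L : ℕ}
    (hL : ∀ c : V → Fin k, L ≤ monoArcs G c) (c : V ⊕ W → Fin (k + 1)) :
    L ≤ monoArcs (joinIndep G W) c := by
  classical
  -- `γ` is the colour rarest on `V`. Each vertex of `W` has at least that many neighbours of its
  -- own colour, which pays for merging `γ` away on `V`.
  obtain ⟨γ, -, hγ⟩ := exists_min_image (univ : Finset (Fin (k + 1)))
    (fun γ => #{v : V | c (.inl v) = γ}) ⟨0, mem_univ _⟩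
  obtain ⟨c', hc'⟩ := exists_monoArcs_le_of_merge G hk hdeg (c ∘ Sum.inl) γ
  have h1 : monoArcs (joinIndep G W) c = monoArcs G (c ∘ Sum.inl) +
      2 * ∑ w : W, #{v : V | c (.inl v) = c (.inr w)} := by
    have h2 : ∑ w : W, #{v : V | c (.inl v) = c (.inr w)} =
        ∑ v : V, ∑ w : W, if c (.inl v) = c (.inr w) then 1 else 0 := by
      rw [sum_comm]
      simp only [card_filter]
    have h3 : ∑ w : W, #{v : V | c (.inl v) = c (.inr w)} =
        ∑ w : W, ∑ v : V, if c (.inr w) = c (.inl v) then 1 else 0 := by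
      simp_rw [card_filter, eq_comm]
    rw [two_mul]
    conv_rhs => enter [2, 1]; rw [h3]
    rw [h2]
    simp [monoArcs, Fintype.sum_sum_type, sum_add_distrib, add_assoc, -sum_boole]
    exact sum_congr rfl fun u _ => sum_congr rfl fun v _ => by congr
  have h4 := card_nsmul_le_sum (univ : Finset W)
    (fun w => #{v : V | c (.inl v) = c (.inr w)}) _ fun w _ => hγ (c (.inr w)) (mem_univ _)
  rw [smul_eq_mul, card_univ, mul_comm] at h4
  have := hL c'
  simp only [Function.comp] at hc'
  change monoArcs G c' ≤ monoArcs G (c ∘ Sum.inl) + _ at hc'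
  omega

end joinIndep

/-- The number of ordered pairs that are adjacent in `G` but not in `H`. -/
noncomputable def missingArcs {V : Type*} [Fintype V] (G H : SimpleGraph V) : ℕ :=
  arcsIn (G \ H) univ

theorem arcsIn_add_missingArcs {V : Type*} [Fintype V] {G H : SimpleGraph V} (h : H ≤ G) :
    arcsIn H univ + missingArcs G H = arcsIn G univ := by
  classical
  simp only [arcsIn, missingArcs, ← sum_add_distrib]
  refine sum_congr rfl fun u _ => sum_congr rfl fun v _ => ?_
  by_cases hH : H.Adj u v
  · simp [hH, h hH]
  · simp [hH]

theorem missingArcs_joinIndep {V W : Type*} [Fintype V] [Fintype W] (G H : SimpleGraph V) :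
    missingArcs (joinIndep G W) (joinIndep H W) = missingArcs G H := by
  simp [missingArcs, arcsIn, -sum_boole]
  rfl

/-- A graph in which deleting the edges outside some `K_{k+1}`-free subgraph costs less than making
it `k`-partite has fewer edges in its largest `k`-partite subgraph. -/
theorem maxPartiteEdges_lt_maxCliqueFreeEdges {V : Type*} [Fintype V] {G H : SimpleGraph V}
    {k : ℕ} (hk : 1 ≤ k) (hHG : H ≤ G) (hH : H.CliqueFree (k + 1))
    (hc : ∀ c : V → Fin k, missingArcs G H < monoArcs G c) :
    maxPartiteEdges G k < maxCliqueFreeEdges G (k + 1) := by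
  obtain ⟨P, hPG, ⟨C⟩, hP⟩ := exists_ncard_eq_maxPartiteEdges G hk
  have h1 := ncard_le_maxCliqueFreeEdges hHG hH
  have h2 := two_mul_ncard_edgeSet H
  have h3 := two_mul_ncard_edgeSet P
  have h4 : arcsIn P univ ≤ arcsIn (cutGraph G C) univ :=
    arcsIn_mono fun u _ v _ h => ⟨hPG h, C.valid h⟩
  have h5 := arcsIn_cutGraph_add_monoArcs G C
  have h6 := arcsIn_add_missingArcs hHG
  have h7 := hc C
  omega

section Comap

variable {V V' : Type*} [Fintype V] [Fintype V'] (e : V' ≃ V)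

theorem degIn_comap (G : SimpleGraph V) (v : V') :
    degIn (G.comap e) v univ = degIn G (e v) univ := by
  classical
  rw [degIn, degIn, ← Equiv.sum_comp e]
  rfl

theorem missingArcs_comap (G H : SimpleGraph V) :
    missingArcs (G.comap e) (H.comap e) = missingArcs G H := by
  rw [missingArcs, missingArcs, arcsIn_eq_sum_degIn, arcsIn_eq_sum_degIn, ← Equiv.sum_comp e]
  exact sum_congr rfl fun u _ => degIn_comap e (G \ H) u

theorem monoArcs_comap {C : Type*} (G : SimpleGraph V) (c : V' → C) :
    monoArcs (G.comap e) c = monoArcs G (c ∘ e.symm) := by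
  classical
  simp only [monoArcs]
  rw [← Equiv.sum_comp e]
  refine sum_congr rfl fun u _ => ?_
  rw [← Equiv.sum_comp e]
  simp

end Comap

/-! ### The pentagon construction for `r = 3`. -/

/-- The blow-up of a pentagon with loops whose classes consist of `12` groups of `h` vertices,
with, in addition, all edges between groups with the same index. -/
def pentagonGraph (h : ℕ) : SimpleGraph (Fin 5 × Fin 12 × Fin h) where
  Adj u v := u ≠ v ∧ (v.1 ≠ u.1 + 2 ∧ u.1 ≠ v.1 + 2 ∨ u.2.1 = v.2.1)
  symm := ⟨fun _ _ ⟨h₁, h₂⟩ => ⟨h₁.symm, h₂.imp And.symm Eq.symm⟩⟩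
  loopless := ⟨fun _ h => h.1 rfl⟩

/-- The blow-up of a pentagon. -/
def pentagonBlowup (h : ℕ) : SimpleGraph (Fin 5 × Fin 12 × Fin h) where
  Adj u v := v.1 = u.1 + 1 ∨ u.1 = v.1 + 1
  symm := ⟨fun _ _ h => h.symm⟩
  loopless := ⟨fun u h => by have : ∀ i : Fin 5, ¬ (i = i + 1 ∨ i = i + 1) := by decide
                             exact this _ h⟩

theorem pentagonBlowup_le (h : ℕ) : pentagonBlowup h ≤ pentagonGraph h := by
  intro u v huv
  have key : ∀ i j : Fin 5, j = i + 1 ∨ i = j + 1 → i ≠ j ∧ j ≠ i + 2 ∧ i ≠ j + 2 := by decide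
  obtain ⟨h1, h2⟩ := key _ _ huv
  exact ⟨fun e => h1 (congrArg Prod.fst e), Or.inl h2⟩

theorem pentagonBlowup_cliqueFree (h : ℕ) : (pentagonBlowup h).CliqueFree 3 := by
  intro t ht
  obtain ⟨a, b, c, hab, hac, hbc, -⟩ := SimpleGraph.is3Clique_iff.1 ht
  have key : ∀ i j l : Fin 5, (j = i + 1 ∨ i = j + 1) → (l = i + 1 ∨ i = l + 1) →
    ¬ (l = j + 1 ∨ j = l + 1) := by decide
  exact key _ _ _ hab hac hbc

theorem card_pentagon (h : ℕ) : Fintype.card (Fin 5 × Fin 12 × Fin h) = 60 * h := by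
  simp only [Fintype.card_prod, Fintype.card_fin]
  ring

theorem sum_pentagon (h : ℕ) (f : Fin 5 → ℕ) (g : Fin 12 → ℕ) :
    ∑ u : Fin 5 × Fin 12 × Fin h, f u.1 * g u.2.1 = (∑ i, f i) * (∑ j, g j) * h := by
  rw [Fintype.sum_prod_type, sum_mul_sum, sum_mul]
  refine sum_congr rfl fun i _ => ?_
  rw [Fintype.sum_prod_type, sum_mul]
  refine sum_congr rfl fun j _ => ?_
  simp [mul_comm]

theorem degIn_pentagonGraph (h : ℕ) (v : Fin 5 × Fin 12 × Fin h) :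
    degIn (pentagonGraph h) v univ + 22 * h + 1 = 60 * h := by
  classical
  have h1 : degIn (pentagonGraph h) v univ + 22 * h + 1 =
      ∑ u : Fin 5 × Fin 12 × Fin h, ((if (pentagonGraph h).Adj v u then 1 else 0) +
        ((if u.1 = v.1 + 2 ∨ v.1 = u.1 + 2 then 1 else 0) * (if u.2.1 ≠ v.2.1 then 1 else 0)) +
        if u = v then 1 else 0) := by
    rw [sum_add_distrib, sum_add_distrib, sum_ite_eq' univ v, if_pos (mem_univ _)]
    congr 2
    have k1 : ∀ i : Fin 5, (∑ j : Fin 5, if j = i + 2 ∨ i = j + 2 then 1 else 0) = 2 := by decide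
    have k2 : ∀ i : Fin 12, (∑ j : Fin 12, if j ≠ i then 1 else 0) = 11 := by decide
    rw [sum_pentagon h (fun i => if i = v.1 + 2 ∨ v.1 = i + 2 then 1 else 0)
      (fun j => if j ≠ v.2.1 then 1 else 0), k1, k2]
  rw [h1, ← mul_one (60 * h)]
  rw [sum_congr rfl (g := fun _ => 1)]
  · simp; ring
  · intro u _
    by_cases huv : u = v
    · subst huv; simp [pentagonGraph]
    · have : ¬ v = u := fun h => huv h.symm
      simp only [pentagonGraph, ne_eq, huv, this, not_false_eq_true, true_and, if_false]
      have := eq_comm (a := v.2.1) (b := u.2.1)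
      split_ifs <;> first | rfl | (exfalso; tauto)

theorem degIn_pentagonBlowup (h : ℕ) (v : Fin 5 × Fin 12 × Fin h) :
    degIn (pentagonBlowup h) v univ = 24 * h := by
  classical
  have k1 : ∀ i : Fin 5, (∑ j : Fin 5, if j = i + 1 ∨ i = j + 1 then 1 else 0) = 2 := by decide
  have : degIn (pentagonBlowup h) v univ =
      ∑ u : Fin 5 × Fin 12 × Fin h, if u.1 = v.1 + 1 ∨ v.1 = u.1 + 1 then 1 else 0 :=
    sum_congr rfl fun u _ => by simp only [pentagonBlowup]; congr
  have h2 := sum_pentagon h (fun i => if i = v.1 + 1 ∨ v.1 = i + 1 then 1 else 0) (fun _ => 1)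
  rw [k1] at h2
  simp only [mul_one, sum_const, card_univ, Fintype.card_fin, smul_eq_mul] at h2
  rw [this, h2]

theorem missingArcs_pentagon (h : ℕ) :
    missingArcs (pentagonGraph h) (pentagonBlowup h) + 60 * h = 840 * h ^ 2 := by
  have h1 := arcsIn_add_missingArcs (pentagonBlowup_le h)
  have h2 : arcsIn (pentagonBlowup h) univ = 60 * h * (24 * h) := by
    rw [arcsIn_eq_sum_degIn, sum_congr rfl fun v _ => degIn_pentagonBlowup h v, sum_const,
      card_univ, card_pentagon, smul_eq_mul]
  have h3 : arcsIn (pentagonGraph h) univ + 60 * h * (22 * h + 1) = 60 * h * (60 * h) := by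
    rw [arcsIn_eq_sum_degIn]
    have : ∑ v : Fin 5 × Fin 12 × Fin h, (degIn (pentagonGraph h) v univ + (22 * h + 1)) =
        60 * h * (60 * h) := by
      rw [sum_congr rfl fun v _ => (add_assoc _ _ _).symm.trans (degIn_pentagonGraph h v),
        sum_const, card_univ, card_pentagon, smul_eq_mul]
    rwa [sum_add_distrib, sum_const, card_univ, card_pentagon, smul_eq_mul] at this
  nlinarith

/-- A sum around a pentagon with two consecutive terms of the same sign. -/
theorem pentagon_quadratic_path {m a b c d e : ℤ} (hb : b ^ 2 ≤ m ^ 2)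
    (hc : c ^ 2 ≤ m ^ 2) (hd : d ^ 2 ≤ m ^ 2) (h : 0 ≤ e * a) :
    -3 * m ^ 2 ≤ a ^ 2 + b ^ 2 + c ^ 2 + d ^ 2 + e ^ 2 +
      2 * (a * b + b * c + c * d + d * e + e * a) := by
  -- The form is the sum of these four squares minus `b² + c² + d²` plus `2ea`.
  nlinarith [sq_nonneg (a + b), sq_nonneg (b + c), sq_nonneg (c + d), sq_nonneg (d + e)]

theorem pentagon_quadratic {m : ℤ} (z : Fin 5 → ℤ) (hz : ∀ i, z i ^ 2 ≤ m ^ 2) :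
    -3 * m ^ 2 ≤ ∑ i, (z i ^ 2 + 2 * (z i * z (i + 1))) := by
  have hs : ∑ i, (z i ^ 2 + 2 * (z i * z (i + 1))) = z 0 ^ 2 + z 1 ^ 2 + z 2 ^ 2 + z 3 ^ 2 +
      z 4 ^ 2 + 2 * (z 0 * z 1 + z 1 * z 2 + z 2 * z 3 + z 3 * z 4 + z 4 * z 0) := by
    simp [Fin.sum_univ_five]
    ring
  rw [hs]
  by_cases h0 : 0 ≤ z 0 * z 1
  · linarith [pentagon_quadratic_path (hz 2) (hz 3) (hz 4) h0]
  by_cases h1 : 0 ≤ z 1 * z 2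
  · linarith [pentagon_quadratic_path (hz 3) (hz 4) (hz 0) h1]
  by_cases h2 : 0 ≤ z 2 * z 3
  · linarith [pentagon_quadratic_path (hz 4) (hz 0) (hz 1) h2]
  by_cases h3 : 0 ≤ z 3 * z 4
  · linarith [pentagon_quadratic_path (hz 0) (hz 1) (hz 2) h3]
  -- The five cyclic products cannot all be negative: their product is a square.
  refine (pentagon_quadratic_path (a := z 0) (e := z 4) (hz 1) (hz 2) (hz 3) ?_).trans_eq (by ring)
  by_contra! h4
  push Not at h0 h1 h2 h3
  have := mul_pos_of_neg_of_neg h0 h1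
  have h5 := mul_neg_of_pos_of_neg (mul_pos_of_neg_of_neg (mul_neg_of_pos_of_neg this h2) h3) h4
  nlinarith [sq_nonneg (z 0 * z 1 * z 2 * z 3 * z 4)]

/-- Only arcs within classes and between consecutive classes are needed. With `m = 12h` and `z i`
the difference of the two colour counts in class `i`, twice their monochromatic count, loops
included, is `15m²` plus the form of `pentagon_quadratic`, hence at least `12m²`. -/
theorem le_monoArcs_pentagonGraph (h : ℕ) (c : Fin 5 × Fin 12 × Fin h → Fin 2) :
    864 * h ^ 2 ≤ monoArcs (pentagonGraph h) c + 60 * h := by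
  classical
  let x (a : Fin 2) (i : Fin 5) : ℕ := ∑ p : Fin 12 × Fin h, if c (i, p) = a then 1 else 0
  have hx : ∀ i, x 0 i + x 1 i = 12 * h := by
    intro i
    simp only [x, ← sum_add_distrib]
    rw [sum_congr rfl (g := fun _ => 1)]
    · simp
    · intro p _
      have : ∀ a : Fin 2, ((if a = 0 then 1 else 0) + if a = 1 then 1 else 0) = 1 := by decide
      exact this _
  have hpair : ∀ i j, (∑ p : Fin 12 × Fin h, ∑ q : Fin 12 × Fin h,
      if c (i, p) = c (j, q) then 1 else 0) = x 0 i * x 0 j + x 1 i * x 1 j := by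
    intro i j
    simp only [x, sum_mul_sum, ← sum_add_distrib]
    refine sum_congr rfl fun p _ => sum_congr rfl fun q _ => ?_
    have : ∀ a b : Fin 2, (if a = b then 1 else 0) = (if a = 0 then 1 else 0) *
      (if b = 0 then 1 else 0) + (if a = 1 then 1 else 0) * (if b = 1 then 1 else 0) := by decide
    exact this _ _
  have hmono : ∑ i, (x 0 i * x 0 i + x 1 i * x 1 i +
      2 * (x 0 i * x 0 (i + 1) + x 1 i * x 1 (i + 1))) ≤
      monoArcs (pentagonGraph h) c + 60 * h := by
    have e0 : ∑ i : Fin 5, (x 0 i * x 0 (i + 1) + x 1 i * x 1 (i + 1)) =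
        ∑ i, (x 0 i * x 0 (i - 1) + x 1 i * x 1 (i - 1)) := by
      rw [← Equiv.sum_comp (Equiv.addRight (1 : Fin 5))
        (fun i => x 0 i * x 0 (i - 1) + x 1 i * x 1 (i - 1))]
      exact sum_congr rfl fun i _ => by simp [mul_comm]
    -- The `60h` counts the diagonal pairs, included in the products of colour counts but not arcs.
    have e1 : 60 * h = ∑ u : Fin 5 × Fin 12 × Fin h,
        ∑ v : Fin 5 × Fin 12 × Fin h, if u = v then 1 else 0 := by
      simp; ring
    rw [sum_add_distrib, ← mul_sum, two_mul]
    conv_lhs => enter [2, 2]; rw [e0]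
    rw [e1, monoArcs, ← sum_add_distrib, ← sum_add_distrib, ← sum_add_distrib,
      Fintype.sum_prod_type]
    refine sum_le_sum fun i _ => ?_
    have e2 : ∀ p : Fin 12 × Fin h, ∑ v : Fin 5 × Fin 12 × Fin h,
        (if v.1 = i ∨ v.1 = i + 1 ∨ v.1 = i - 1 then if c (i, p) = c v then 1 else 0 else 0) ≤
        (∑ v, if (pentagonGraph h).Adj (i, p) v ∧ c (i, p) = c v then 1 else 0) +
          ∑ v, if (i, p) = v then 1 else 0 := by
      intro p
      rw [← sum_add_distrib]
      refine sum_le_sum fun v _ => ?_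
      have key : ∀ i j : Fin 5, j = i ∨ j = i + 1 ∨ j = i - 1 → j ≠ i + 2 ∧ i ≠ j + 2 := by
        decide
      by_cases hv : v.1 = i ∨ v.1 = i + 1 ∨ v.1 = i - 1
      · rw [if_pos hv]
        by_cases hcv : c (i, p) = c v
        · by_cases hne : (i, p) = v
          · simp [hne]
          · have : (pentagonGraph h).Adj (i, p) v := ⟨hne, Or.inl (key _ _ hv)⟩
            simp [this, hcv]
        · simp [hcv]
      · simp [hv]
    simp only [sum_add_distrib]
    rw [← sum_add_distrib]
    refine le_trans (le_of_eq ?_) (sum_le_sum fun p _ => (e2 p).trans_eq ?_)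
    swap
    · congr!
    simp_rw [Fintype.sum_prod_type (α₁ := Fin 5)]
    rw [sum_comm]
    have e3 : ∀ j : Fin 5, (∑ p : Fin 12 × Fin h, ∑ q : Fin 12 × Fin h,
        if j = i ∨ j = i + 1 ∨ j = i - 1 then if c (i, p) = c (j, q) then 1 else 0 else 0) =
        if j = i ∨ j = i + 1 ∨ j = i - 1 then x 0 i * x 0 j + x 1 i * x 1 j else 0 := by
      intro j
      by_cases hj : j = i ∨ j = i + 1 ∨ j = i - 1
      · simp only [hj, if_true, hpair]
      · simp [hj]
    rw [sum_congr rfl fun j _ => e3 j, ← sum_filter]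
    have e4 : ∀ i : Fin 5, (univ.filter fun j : Fin 5 => j = i ∨ j = i + 1 ∨ j = i - 1) =
        {i, i + 1, i - 1} := by decide
    have e5 : ∀ i : Fin 5, i ∉ ({i + 1, i - 1} : Finset (Fin 5)) := by decide
    have e6 : ∀ i : Fin 5, i + 1 ∉ ({i - 1} : Finset (Fin 5)) := by decide
    rw [e4, sum_insert (e5 i), sum_insert (e6 i), sum_singleton]
  refine le_trans ?_ hmono
  have hq := pentagon_quadratic (m := 12 * h) (fun i => (x 0 i : ℤ) - x 1 i) fun i => by
    have := hx i
    zify at this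
    rw [← this]
    nlinarith [mul_nonneg (Int.natCast_nonneg (x 0 i)) (Int.natCast_nonneg (x 1 i))]
  have hi : ∀ i, (2 : ℤ) * (x 0 i * x 0 i + x 1 i * x 1 i +
      2 * (x 0 i * x 0 (i + 1) + x 1 i * x 1 (i + 1))) = 3 * (12 * h) ^ 2 +
      (((x 0 i : ℤ) - x 1 i) ^ 2 + 2 * (((x 0 i : ℤ) - x 1 i) * (x 0 (i + 1) - x 1 (i + 1)))) := by
    intro i
    have h1 := hx i
    have h2 := hx (i + 1)
    zify at h1 h2
    have h3 : (12 * (h : ℤ)) * (12 * h) = (x 0 i + x 1 i) * (x 0 (i + 1) + x 1 (i + 1)) := by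
      rw [h1, h2]
    rw [show (3 : ℤ) * (12 * h) ^ 2 = (12 * h) ^ 2 + 2 * ((12 * h) * (12 * h)) by ring, h3, ← h1]
    ring
  have hs := congrArg (fun f : Fin 5 → ℤ => ∑ i, f i) (funext hi)
  simp only [← mul_sum] at hs
  rw [sum_add_distrib (f := fun _ => 3 * (12 * (h : ℤ)) ^ 2)] at hs
  simp only [sum_const, card_univ, Fintype.card_fin] at hs
  zify
  rw [nsmul_eq_mul] at hs
  push_cast at hs ⊢
  nlinarith

/-! ### Passing to general `r`, and the threshold. -/

/-- Joining `q` independent sets to the pentagon graph. -/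
theorem exists_graph_of_pentagon {h : ℕ} (hh : 0 < h) (q : ℕ) :
    ∃ (V : Type) (_ : Fintype V) (G H : SimpleGraph V), Fintype.card V = 60 * h + 22 * h * q ∧
      (∀ v, degIn G v univ + 22 * h ≤ Fintype.card V ∧
        Fintype.card V ≤ degIn G v univ + 22 * h + 1) ∧
      H ≤ G ∧ H.CliqueFree (q + 3) ∧ missingArcs G H + 60 * h = 840 * h ^ 2 ∧
      ∀ c : V → Fin (q + 2), 840 * h ^ 2 + 1 - 60 * h ≤ monoArcs G c := by
  induction q with
  | zero =>
    refine ⟨_, inferInstance, pentagonGraph h, pentagonBlowup h,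
      by rw [card_pentagon]; simp, fun v => ?_,
      pentagonBlowup_le h, pentagonBlowup_cliqueFree h, missingArcs_pentagon h, fun c => ?_⟩
    · have := degIn_pentagonGraph h v
      have := card_pentagon h
      omega
    · have := le_monoArcs_pentagonGraph h c
      have : 0 < h ^ 2 := by positivity
      omega
  | succ q ih =>
    obtain ⟨V, _, G, H, hV, hdeg, hHG, hH, hmiss, hmono⟩ := ih
    have hcard : Fintype.card (V ⊕ Fin (22 * h)) = Fintype.card V + 22 * h := by simp
    -- Independent sets of size `22h` give the new vertices the same number of non-neighbours, up to
    -- one, as the old ones.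
    refine ⟨V ⊕ Fin (22 * h), inferInstance, joinIndep G _, joinIndep H _, ?_, ?_,
      joinIndep_mono hHG, joinIndep_cliqueFree hH, by rwa [missingArcs_joinIndep], ?_⟩
    · rw [hcard, hV]; ring
    · rintro (v | w)
      · rw [degIn_joinIndep_inl, hcard, Fintype.card_fin]
        have := hdeg v
        omega
      · rw [degIn_joinIndep_inr, hcard]
        omega
    · refine monoArcs_joinIndep (by omega) (fun v => ?_) hmono
      have := (hdeg v).1
      rw [Fintype.card_fin]
      nlinarith

theorem not_forcesPartiteEqCliqueFree {r : ℕ} (hr : 3 ≤ r) {δ : ℝ}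
    (hδ : δ < 1 - 22 / (22 * r - 6)) : ¬ ForcesPartiteEqCliqueFree r δ := by
  classical
  rintro ⟨N, hN⟩
  obtain ⟨q, rfl⟩ := Nat.exists_eq_add_of_le' hr
  have hpos : (0 : ℝ) < 22 * q + 60 := by positivity
  -- Large enough that the gap below the limiting ratio, times the number of vertices, exceeds the
  -- `1` lost because a vertex is not its own neighbour.
  obtain ⟨h, hh⟩ := exists_nat_gt (max (N : ℝ) (1 / ((22 * q + 60) * (1 - 22 / (22 * q + 60) - δ))))
  have hNh : N < h := by exact_mod_cast (le_max_left _ _).trans_lt hh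
  obtain ⟨V, _, G, H, hV, hdeg, hHG, hH, hmiss, hmono⟩ := exists_graph_of_pentagon (h := h)
    (by omega) q
  let e : Fin (60 * h + 22 * h * q) ≃ V := (Fintype.equivFinOfCardEq hV).symm
  have hlt := maxPartiteEdges_lt_maxCliqueFreeEdges (G := G.comap e) (H := H.comap e)
    (k := q + 2) (by omega) (fun _ _ huv => hHG huv)
    (hH.comap (SimpleGraph.Embedding.comap e.toEmbedding H).isContained) (fun c => by
      rw [missingArcs_comap, monoArcs_comap]
      have := hmono (c ∘ e.symm)
      omega)
  refine hlt.ne (hN _ (by nlinarith) (G.comap e) ?_)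
  have hV0 : 0 < 60 * h + 22 * h * q := by omega
  have : Nonempty (Fin (60 * h + 22 * h * q)) := ⟨⟨0, hV0⟩⟩
  obtain ⟨v, hv⟩ := (G.comap e).exists_minimal_degree_vertex
  have hd : (G.comap e).degree v = degIn G (e v) univ := by
    rw [← degIn_comap, degIn_eq_card, ← SimpleGraph.card_neighborFinset_eq_degree,
      SimpleGraph.neighborFinset_eq_filter]
  rw [hv, hd]
  have h1 := (hdeg (e v)).2
  rw [hV] at h1
  have h2 : (60 * h + 22 * h * q : ℝ) ≤ degIn G (e v) univ + 22 * h + 1 := by exact_mod_cast h1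
  have h3 := (le_max_right _ _).trans_lt hh
  push_cast at hδ ⊢
  rw [show (22 : ℝ) * (q + 3) - 6 = 22 * q + 60 by ring] at hδ
  have h4 : 0 < 1 - 22 / (22 * q + 60) - δ := by linarith
  rw [div_lt_iff₀ (by positivity)] at h3
  have h5 : (22 * q + 60 : ℝ) * (22 / (22 * q + 60)) = 22 := by field_simp
  have h6 : (h : ℝ) * ((22 * q + 60) * (1 - 22 / (22 * q + 60) - δ)) =
    h * (22 * q + 60 - 22 - (22 * q + 60) * δ) := by linear_combination -h * h5
  linarith

theorem theorem1 (r : ℕ) (hr : 4 ≤ r) :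
    (3 * (r : ℝ) - 4) / (3 * (r : ℝ) - 1) < degreeThreshold r ∧
      degreeThreshold r ≤
        (4 * (3 * (r : ℝ) - 7) * ((r : ℝ) - 1) + 1) /
          (4 * ((r : ℝ) - 2) * (3 * (r : ℝ) - 4)) := by
  have hr' : (4 : ℝ) ≤ r := by exact_mod_cast hr
  have hlow : ∀ δ ∈ {δ : ℝ | ForcesPartiteEqCliqueFree r δ}, 1 - 22 / (22 * (r : ℝ) - 6) ≤ δ := by
    intro δ hδ
    by_contra! hlt
    exact not_forcesPartiteEqCliqueFree (by omega) hlt hδ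
  have hup : ∀ δ, (4 * (3 * (r : ℝ) - 7) * ((r : ℝ) - 1) + 1) /
      (4 * ((r : ℝ) - 2) * (3 * (r : ℝ) - 4)) < δ → ForcesPartiteEqCliqueFree r δ :=
    fun δ hδ => forcesPartiteEqCliqueFree_of_lt (by omega) hδ
  constructor
  · refine lt_of_lt_of_le ?_ (le_csInf ⟨_, hup _ (lt_add_one _)⟩ hlow)
    -- Strictness amounts to `3/11 < 1/3`: the ratios are `1 - 1/(r - 3/11)` and `1 - 1/(r - 1/3)`.
    rw [one_sub_div (by linarith), div_lt_div_iff₀ (by linarith) (by linarith)]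
    nlinarith
  · exact le_of_forall_gt_imp_ge_of_dense fun δ hδ => csInf_le ⟨_, hlow⟩ (hup δ hδ)
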